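/- A continuum is a nonempty compact connected metric space. For a continuum $X$ let $2^X$ be the space of nonempty closed subsets of $X$ with the Hausdorff metric, and let $C(X)\subseteq 2^X$ be the set of subcontinua of $X$. $X$ is decomposable if it is the union of two proper subcontinua. $X$ has the property of Kelley if, whenever $x_n\to x$ in $X$ and $x\in A\in C(X)$, there are $A_n\in C(X)$ with $x_n\in A_n$ for every $n$ and $A_n\to A$ in $2^X$. Let $\mathcal{NB}(\mathcal F_1(X))\subseteq 2^X$ be the subspace of all proper closed sets $\emptyset\neq A\subsetneq X$ such that for every $x\in X\setminus A$ the union of all subcontinua of $X$ that contain $x$ and lie in $X\setminus A$ is dense in $X$. For $x\in X$ let $\pi(x)=\bigcap\{A\in\mathcal{NB}(\mathcal F_1(X)) : x\in A\}$ if some member of $\mathcal{NB}(\mathcal F_1(X))$ contains $x$, and $\pi(x)=X$ otherwise. Let $\mathcal L=\{\pi(x) : x\in X\}$, and let $\mathcal N$ be the set of members of $\mathcal L$ that are minimal in $\mathcal L$ with respect to inclusion. A decomposition $\mathcal D$ of $X$ (a partition of $X$ into nonempty sets) is upper semicontinuous if for each $D\in\mathcal D$ and each open $U\supseteq D$ there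 is an open $V\supseteq D$ such that every $A\in\mathcal D$ meeting $V$ is contained in $U$; it is lower semicontinuous if for each $D\in\mathcal D$, all $x,y\in D$ and each open $U\ni x$ there is an open $V\ni y$ such that every $A\in\mathcal D$ meeting $V$ meets $U$; it is continuous if it is both. Theorem. Let $X$ be a decomposable continuum with the property of Kelley such that $\mathcal{NB}(\mathcal F_1(X))$ is a continuum. Then for every $x\in X$ the set $\pi(x)$ is the least (with respect to inclusion) member of $\mathcal{NB}(\mathcal F_1(X))$ containing $x$, and $\pi(x)$ is minimal in $\mathcal L$. Hence $\mathcal L=\mathcal N$, and $\mathcal L=\{\pi(x) : x\in X\}$ is a continuous decomposition of $X$. -/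

import Mathlib

open Set Filter Topology TopologicalSpace

namespace Continua

/-- A subset of a metric space is a continuum if it is nonempty, compact and connected. -/
def IsContinuum {Y : Type*} [MetricSpace Y] (S : Set Y) : Prop :=
  IsCompact S ∧ IsConnected S

section

variable (X : Type*) [MetricSpace X]

/-- The hyperspace `C(X)` of subcontinua of `X`. For compact `X`, the hyperspace `2^X` of nonempty
closed subsets with the Hausdorff metric is Mathlib's `NonemptyCompacts X`. -/
def subcontinua : Set (NonemptyCompacts X) :=
  {L | IsConnected (L : Set X)}

/-- `X` is the union of two of its proper subcontinua. -/
def Decomposable : Prop :=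
  ∃ M ∈ subcontinua X, ∃ N ∈ subcontinua X,
    (M : Set X) ≠ univ ∧ (N : Set X) ≠ univ ∧ (M : Set X) ∪ (N : Set X) = univ

/-- The property of Kelley. -/
def KelleyProperty : Prop :=
  ∀ (u : ℕ → X) (x : X), Tendsto u atTop (𝓝 x) →
    ∀ A ∈ subcontinua X, x ∈ A →
      ∃ K : ℕ → NonemptyCompacts X,
        (∀ n, K n ∈ subcontinua X ∧ u n ∈ K n) ∧ Tendsto K atTop (𝓝 A)

end

section

variable {X : Type*} [MetricSpace X]

/-- `κ_{X ∖ A}(B)`: the union of the subcontinua of `X` that meet `B` and lie in `X ∖ A`. -/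
def kappa (A B : Set X) : Set X :=
  {z | ∃ L ∈ subcontinua X, (B ∩ (L : Set X)).Nonempty ∧ (L : Set X) ⊆ Aᶜ ∧ z ∈ L}

/-- `A` does not block `B`. -/
def DoesNotBlock (A B : Set X) : Prop :=
  Disjoint A B ∧ Dense (kappa A B)

end

section

variable (X : Type*) [MetricSpace X]

/-- The hyperspace `NB(F₁(X))` of nonblockers of the one-point sets. The whole space `X`, for which
the blocking condition is vacuous, is not counted as a nonblocker. -/
def NB : Set (NonemptyCompacts X) :=
  {A | (A : Set X) ≠ univ ∧ ∀ x, x ∉ A → DoesNotBlock (A : Set X) {x}}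

variable {X} in
open Classical in
/-- `π(x)`: the intersection of all nonblockers containing `x` if there are any, and `X` if not. -/
noncomputable def minNB (x : X) : Set X :=
  if ∃ A ∈ NB X, x ∈ A then {z | ∀ A ∈ NB X, x ∈ A → z ∈ A} else univ

/-- The family `𝓛 = {π(x) : x ∈ X}`. -/
def familyL : Set (Set X) :=
  {S | ∃ x : X, S = minNB x}

/-- The family `𝓝` of those members of `𝓛` that are minimal in `𝓛` with respect to inclusion. -/
def familyN : Set (Set X) :=
  {S | Minimal (fun T => T ∈ familyL X) S}

end

section

variable {X : Type*} [TopologicalSpace X]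

/-- Upper semicontinuity of a decomposition. -/
def IsUpperSemicontinuousDecomp (𝓓 : Set (Set X)) : Prop :=
  ∀ D ∈ 𝓓, ∀ U : Set X, IsOpen U → D ⊆ U →
    ∃ V : Set X, IsOpen V ∧ D ⊆ V ∧ ∀ A ∈ 𝓓, (A ∩ V).Nonempty → A ⊆ U

/-- Lower semicontinuity of a decomposition. -/
def IsLowerSemicontinuousDecomp (𝓓 : Set (Set X)) : Prop :=
  ∀ D ∈ 𝓓, ∀ x ∈ D, ∀ y ∈ D, ∀ U : Set X, IsOpen U → x ∈ U →
    ∃ V : Set X, IsOpen V ∧ y ∈ V ∧ ∀ A ∈ 𝓓, (A ∩ V).Nonempty → (A ∩ U).Nonempty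

/-- A continuous decomposition: a partition into nonempty sets that is both upper and lower
semicontinuous. -/
def IsContinuousDecomposition (𝓓 : Set (Set X)) : Prop :=
  Setoid.IsPartition 𝓓 ∧ IsUpperSemicontinuousDecomp 𝓓 ∧ IsLowerSemicontinuousDecomp 𝓓

end

end Continua

/-!
Throughout, a *fat* continuum is a subcontinuum of `X` with nonempty interior, and `x`, `y` are joined
off `A` if a subcontinuum of `X` missing `A` contains both.

The property of Kelley gives two facts about a fat continuum `W` missing a closed set `A`. The set `O`
of points joined to `W` off `A` is open (`KelleyProperty.isOpen_setOf_joinedOff`), and if `O` is dense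
then its complement is a nonblocker (`KelleyProperty.isNonblocker_compl`). A minimality argument then
produces a nonblocker disjoint from any given proper fat continuum. On the other hand, if `X = M ∪ N`
is a decomposition and `S` is closed, connected and contained in no proper fat continuum, then `S = X`,
because otherwise `M ∪ S` or `S` itself would be such a fat continuum
(`Decomposable.eq_univ_of_not_subset_isFat`). This principle is used twice.

* The union of all nonblockers is closed since the hyperspace of nonblockers is compact, and connected
  since the hyperspace is connected. Hence it is `X`, so every point lies in a nonblocker. As nonempty
  intersections of nonblockers are nonblockers, `π(x)` is the least nonblocker containing `x`.
* The set of points `x` for which `π(x)` is minimal is closed and connected once `π` is known to be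
  continuous, and every nonblocker contains such a point. Hence all `π(x)` are minimal.

Lower semicontinuity of `π` follows from compactness of the hyperspace. For upper semicontinuity the
key fact is that a fat continuum missing `x` misses `π(x)` (`KelleyProperty.disjoint_minNB`). If some
fat continuum misses `x`, then every point outside `π(x)` is interior to a fat continuum missing `π(x)`,
which then misses `π(x')` for all `x'` near `x`. That each point is missed by a fat continuum
(`Decomposable.exists_isFat_notMem`) again uses compactness of the hyperspace: otherwise, for a proper
fat continuum `K` with the given point in its interior, the components of the complement of the
interior of `K` would be nowhere dense, so that all finite subsets of `Kᶜ` could be approximated by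
sets with points in different components. Such sets lie in nonblockers, and in the limit a nonblocker
would contain the open set `Kᶜ`, although nonblockers have empty interior.

Minimality makes the sets `π(x)` a partition, and the two semicontinuity properties of `π` are those of
the decomposition.
-/

open Set Filter Topology TopologicalSpace

namespace Continua

section

variable {X : Type*} [MetricSpace X]

/-! ### Boundary bumping -/

theorem isClosed_connectedComponentIn {F : Set X} (hF : IsClosed F) (z : X) :
    IsClosed (connectedComponentIn F z) := by
  by_cases hz : z ∈ F
  · rw [connectedComponentIn_eq_image hz]
    exact hF.isClosedEmbedding_subtypeVal.isClosedMap _ isClosed_connectedComponent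
  · rw [connectedComponentIn_eq_empty hz]
    exact isClosed_empty

/-- The boundary bumping theorem: if a continuum `J` meets the open set `U`, then every component of
`J \ U` reaches the closure of `U`. -/
theorem connectedComponentIn_diff_inter_closure_nonempty [CompactSpace X] {J U : Set X}
    (hJ : IsClosed J) (hJc : IsPreconnected J) (hU : IsOpen U) (hJU : (J ∩ U).Nonempty)
    {z : X} (hzJ : z ∈ J) (hzU : z ∉ U) :
    (connectedComponentIn (J \ U) z ∩ closure U).Nonempty := by
  by_contra hne
  have hF : IsClosed (J \ U) := hJ.sdiff hU
  have hz : z ∈ J \ U := ⟨hzJ, hzU⟩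
  have : CompactSpace (J \ U : Set X) := isCompact_iff_compactSpace.1 hF.isCompact
  set V : Set (J \ U : Set X) := Subtype.val ⁻¹' (closure U)ᶜ
  have hV : IsOpen V := isClosed_closure.isOpen_compl.preimage continuous_subtype_val
  have hsub : connectedComponent (⟨z, hz⟩ : (J \ U : Set X)) ⊆ V := by
    intro p hp hpU
    apply hne
    refine ⟨p, ?_, hpU⟩
    rw [connectedComponentIn_eq_image hz]
    exact ⟨p, hp, rfl⟩
  rw [connectedComponent_eq_iInter_isClopen] at hsub
  have : Nonempty {s : Set (J \ U : Set X) // IsClopen s ∧ (⟨z, hz⟩ : (J \ U : Set X)) ∈ s} :=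
    ⟨⟨univ, isClopen_univ, mem_univ _⟩⟩
  -- In a compact Hausdorff space a component is an intersection of clopen sets, and by compactness
  -- one of these is already disjoint from the closure of `U`.
  obtain ⟨Q, hQ⟩ := exists_subset_nhds_of_isCompact' (V := fun s : {s : Set (J \ U : Set X) //
      IsClopen s ∧ (⟨z, hz⟩ : (J \ U : Set X)) ∈ s} => (s : Set (J \ U : Set X)))
    (by
      intro s t
      refine ⟨⟨s.1 ∩ t.1, s.2.1.inter t.2.1, s.2.2, t.2.2⟩, ?_, ?_⟩
      · exact inter_subset_left
      · exact inter_subset_right)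
    (fun s => s.2.1.isClosed.isCompact) (fun s => s.2.1.isClosed)
    (fun p hp => hV.mem_nhds (hsub hp))
  obtain ⟨⟨Q, hQc, hzQ⟩, hQV⟩ : ∃ s : {s : Set (J \ U : Set X) //
      IsClopen s ∧ (⟨z, hz⟩ : (J \ U : Set X)) ∈ s}, (s : Set (J \ U : Set X)) ⊆ V := ⟨Q, hQ⟩
  obtain ⟨G, hG, hGQ⟩ := isOpen_induced_iff.1 hQc.isOpen
  have hQcl : IsClosed (Subtype.val '' Q : Set X) :=
    hF.isClosedEmbedding_subtypeVal.isClosedMap _ hQc.isClosed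
  have hGV : J ∩ (G ∩ (closure U)ᶜ) = Subtype.val '' Q := by
    ext p
    constructor
    · rintro ⟨hpJ, hpG, hpU⟩
      refine ⟨⟨p, hpJ, fun h => hpU (subset_closure h)⟩, ?_, rfl⟩
      rw [← hGQ]
      exact hpG
    · rintro ⟨p, hp, rfl⟩
      refine ⟨p.2.1, ?_, hQV hp⟩
      rw [← hGQ] at hp
      exact hp
  obtain ⟨u, huJ, huU⟩ := hJU
  obtain ⟨p, hpJ, hp1, hp2⟩ := hJc (G ∩ (closure U)ᶜ) (Subtype.val '' Q)ᶜ
    (hG.inter isClosed_closure.isOpen_compl) hQcl.isOpen_compl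
    (by
      intro p hp
      by_cases h : p ∈ (Subtype.val '' Q : Set X)
      · rw [← hGV] at h
        exact Or.inl h.2
      · exact Or.inr h)
    ⟨z, by
      rw [hGV]
      exact ⟨⟨z, hz⟩, hzQ, rfl⟩⟩
    ⟨u, huJ, by
      rintro ⟨p, -, rfl⟩
      exact p.2.2 huU⟩
  exact hp2 (hGV ▸ ⟨hpJ, hp1⟩)

/-! ### Points joined by continua off a closed set -/

/-- `x` and `y` lie in a common subcontinuum (of the compact space `X`) that misses `A`. -/
def JoinedOff (A : Set X) (x y : X) : Prop :=
  ∃ L : Set X, IsClosed L ∧ IsPreconnected L ∧ x ∈ L ∧ y ∈ L ∧ Disjoint L A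

theorem JoinedOff.symm {A : Set X} {x y : X} (h : JoinedOff A x y) : JoinedOff A y x := by
  obtain ⟨L, h1, h2, h3, h4, h5⟩ := h
  exact ⟨L, h1, h2, h4, h3, h5⟩

theorem JoinedOff.trans {A : Set X} {x y z : X} (h : JoinedOff A x y) (h' : JoinedOff A y z) :
    JoinedOff A x z := by
  obtain ⟨L, h1, h2, h3, h4, h5⟩ := h
  obtain ⟨K, k1, k2, k3, k4, k5⟩ := h'
  exact ⟨L ∪ K, h1.union k1, h2.union y h4 k3 k2, Or.inl h3, Or.inr k4,
    disjoint_union_left.2 ⟨h5, k5⟩⟩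

theorem JoinedOff.mono {A B : Set X} {x y : X} (h : JoinedOff A x y) (hBA : B ⊆ A) :
    JoinedOff B x y := by
  obtain ⟨L, h1, h2, h3, h4, h5⟩ := h
  exact ⟨L, h1, h2, h3, h4, h5.mono_right hBA⟩

theorem JoinedOff.refl {A : Set X} {x : X} (hx : x ∉ A) : JoinedOff A x x :=
  ⟨{x}, isClosed_singleton, isPreconnected_singleton, rfl, rfl, disjoint_singleton_left.2 hx⟩

theorem JoinedOff.right_notMem {A : Set X} {x y : X} (h : JoinedOff A x y) : y ∉ A := by
  obtain ⟨L, h1, h2, h3, h4, h5⟩ := h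
  exact fun hy => disjoint_left.1 h5 h4 hy

theorem isPreconnected_setOf_joinedOff (A : Set X) (w : X) :
    IsPreconnected {z | JoinedOff A w z} := by
  apply isPreconnected_of_forall w
  rintro z ⟨L, h1, h2, h3, h4, h5⟩
  exact ⟨L, fun p hp => ⟨L, h1, h2, h3, hp, h5⟩, h3, h4, h2⟩

/-- A closed connected set with nonempty interior. -/
structure IsFat (W : Set X) : Prop where
  isClosed : IsClosed W
  isPreconnected : IsPreconnected W
  interior_nonempty : (interior W).Nonempty

theorem IsFat.nonempty {W : Set X} (hW : IsFat W) : W.Nonempty :=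
  hW.interior_nonempty.mono interior_subset

theorem IsFat.joinedOff {W A : Set X} (hW : IsFat W) (hWA : Disjoint W A) {x y : X} (hx : x ∈ W)
    (hy : y ∈ W) : JoinedOff A x y :=
  ⟨W, hW.isClosed, hW.isPreconnected, hx, hy, hWA⟩

/-! ### Nonblockers -/

/-- A proper nonempty closed set `A` such that the points that can be joined off `A` to a given
point outside `A` are dense. For compact `X` this is membership in `NB X`. -/
structure IsNonblocker (A : Set X) : Prop where
  isClosed : IsClosed A
  nonempty : A.Nonempty
  ne_univ : A ≠ univ
  dense : ∀ x, x ∉ A → Dense {z | JoinedOff A x z}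

theorem kappa_singleton [CompactSpace X] (A : Set X) (x : X) :
    kappa A {x} = {z | JoinedOff A x z} := by
  ext z
  constructor
  · rintro ⟨L, hL, ⟨p, rfl, hp⟩, hLA, hz⟩
    exact ⟨L, L.isCompact.isClosed, IsConnected.isPreconnected hL, hp, hz,
      disjoint_left.2 fun q hq hqA => hLA hq hqA⟩
  · rintro ⟨L, h1, h2, h3, h4, h5⟩
    exact ⟨⟨⟨L, h1.isCompact⟩, ⟨x, h3⟩⟩, ⟨⟨x, h3⟩, h2⟩, ⟨x, rfl, h3⟩,
      fun p hp hpA => disjoint_left.1 h5 hp hpA, h4⟩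

theorem mem_NB_iff [CompactSpace X] (A : NonemptyCompacts X) :
    A ∈ NB X ↔ IsNonblocker (A : Set X) := by
  constructor
  · rintro ⟨h1, h2⟩
    refine ⟨A.isCompact.isClosed, A.nonempty, h1, fun x hx => ?_⟩
    rw [← kappa_singleton]
    exact (h2 x hx).2
  · intro h
    refine ⟨h.ne_univ, fun x hx => ⟨disjoint_singleton_right.2 hx, ?_⟩⟩
    rw [kappa_singleton]
    exact h.dense x hx

theorem IsNonblocker.exists_mem_NB [CompactSpace X] {A : Set X} (hA : IsNonblocker A) :
    ∃ K ∈ NB X, (K : Set X) = A :=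
  ⟨⟨⟨A, hA.isClosed.isCompact⟩, hA.nonempty⟩, (mem_NB_iff _).2 hA, rfl⟩

theorem IsNonblocker.dense_compl {A : Set X} (hA : IsNonblocker A) : Dense Aᶜ := by
  obtain ⟨x, hx⟩ := (ne_univ_iff_exists_notMem A).1 hA.ne_univ
  exact (hA.dense x hx).mono fun z hz => hz.right_notMem

theorem IsNonblocker.interior_eq_empty {A : Set X} (hA : IsNonblocker A) : interior A = ∅ :=
  interior_eq_empty_iff_dense_compl.2 hA.dense_compl

/-- Any intersection of nonblockers is a nonblocker if it is not empty: continua that miss one of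
the sets miss the intersection. -/
theorem IsNonblocker.sInter {𝓕 : Set (Set X)} (h𝓕 : ∀ A ∈ 𝓕, IsNonblocker A) (hne : 𝓕.Nonempty)
    (hint : (⋂₀ 𝓕).Nonempty) : IsNonblocker (⋂₀ 𝓕) := by
  refine ⟨isClosed_sInter fun A hA => (h𝓕 A hA).isClosed, hint, ?_, ?_⟩
  · obtain ⟨A, hA⟩ := hne
    intro h
    exact (h𝓕 A hA).ne_univ (univ_subset_iff.1 (h ▸ sInter_subset_of_mem hA))
  · intro x hx
    obtain ⟨A, hA, hxA⟩ : ∃ A ∈ 𝓕, x ∉ A := by simpa using hx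
    exact ((h𝓕 A hA).dense x hxA).mono fun z hz => hz.mono (sInter_subset_of_mem hA)

/-- Each of two disjoint closed pieces of a nonblocker is a nonblocker: by boundary bumping, a point
of one piece can be joined, off the other piece, to a point outside both. -/
theorem IsNonblocker.of_union [CompactSpace X] [ConnectedSpace X] {P Q : Set X}
    (h : IsNonblocker (P ∪ Q)) (hP : IsClosed P) (hQ : IsClosed Q) (hPQ : Disjoint P Q)
    (hne : P.Nonempty) : IsNonblocker P := by
  refine ⟨hP, hne, ?_, ?_⟩
  · rintro rfl
    exact h.ne_univ (univ_union Q)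
  intro x hx
  have key : ∃ z, z ∉ P ∪ Q ∧ JoinedOff P x z := by
    by_cases hxQ : x ∈ Q
    · obtain ⟨V, hV, hQV, hVP⟩ := normal_exists_closure_subset hQ hP.isOpen_compl
        (fun p hp hpP => disjoint_left.1 hPQ hpP hp)
      have hxV : x ∉ (closure V)ᶜ := fun hx => hx (subset_closure (hQV hxQ))
      obtain ⟨z, hz, hzV⟩ := connectedComponentIn_diff_inter_closure_nonempty
        isClosed_univ isPreconnected_univ (U := (closure V)ᶜ) isClosed_closure.isOpen_compl
        (by
          obtain ⟨p, hp⟩ := hne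
          exact ⟨p, mem_univ p, fun h => hVP h hp⟩)
        (mem_univ x) hxV
      have hcV : connectedComponentIn (univ \ (closure V)ᶜ) x ⊆ closure V := by
        intro p hp
        simpa using connectedComponentIn_subset _ _ hp
      have hzP : z ∉ P := hVP (hcV hz)
      refine ⟨z, ?_, connectedComponentIn (univ \ (closure V)ᶜ) x,
        isClosed_connectedComponentIn (isClosed_univ.sdiff isClosed_closure.isOpen_compl) x,
        isPreconnected_connectedComponentIn, mem_connectedComponentIn ⟨mem_univ x, hxV⟩, hz,
        disjoint_left.2 fun p hp hpP => hVP (hcV hp) hpP⟩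
      rintro (hz' | hz')
      · exact hzP hz'
      · have : closure (closure V)ᶜ ⊆ Vᶜ :=
          closure_minimal (compl_subset_compl.2 subset_closure) hV.isClosed_compl
        exact this hzV (hQV hz')
    · exact ⟨x, fun h => h.elim hx hxQ, JoinedOff.refl hx⟩
  obtain ⟨z, hz, hxz⟩ := key
  exact (h.dense z hz).mono fun p hp => hxz.trans (JoinedOff.mono hp subset_union_left)

/-! ### Consequences of the property of Kelley -/

theorem KelleyProperty.eventually_exists [CompactSpace X] (hK : KelleyProperty X) {L U G : Set X}
    (hL : IsClosed L) (hLc : IsPreconnected L) (hU : IsOpen U) (hLU : L ⊆ U) (hG : IsOpen G)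
    (hLG : (L ∩ G).Nonempty) {x : X} (hx : x ∈ L) :
    ∀ᶠ y in 𝓝 x, ∃ K : Set X, IsClosed K ∧ IsPreconnected K ∧ y ∈ K ∧ K ⊆ U ∧ (K ∩ G).Nonempty := by
  by_contra hev
  obtain ⟨u, hu, hbad⟩ := exists_seq_forall_of_frequently (not_eventually.1 hev)
  obtain ⟨K, hK1, hK2⟩ := hK u x hu ⟨⟨L, hL.isCompact⟩, ⟨x, hx⟩⟩ ⟨⟨x, hx⟩, hLc⟩ hx
  have h1 := hK2.eventually ((NonemptyCompacts.isOpen_subsets_of_isOpen hU).mem_nhds hLU)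
  have h2 := hK2.eventually ((NonemptyCompacts.isOpen_inter_nonempty_of_isOpen hG).mem_nhds hLG)
  obtain ⟨n, hn1, hn2⟩ := (h1.and h2).exists
  exact hbad n ⟨K n, (K n).isCompact.isClosed, IsConnected.isPreconnected (hK1 n).1, (hK1 n).2,
    hn1, hn2⟩

/-- In a space with the property of Kelley, the points that can be joined off `A` to a fat continuum
missing `A` form an open set. -/
theorem KelleyProperty.isOpen_setOf_joinedOff [CompactSpace X] (hK : KelleyProperty X)
    {A W : Set X} (hA : IsClosed A) (hW : IsFat W) (hWA : Disjoint W A) {w : X} (hw : w ∈ W) :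
    IsOpen {z | JoinedOff A w z} := by
  rw [isOpen_iff_mem_nhds]
  rintro z ⟨L, h1, h2, h3, h4, h5⟩
  have hdis : Disjoint (L ∪ W) A := disjoint_union_left.2 ⟨h5, hWA⟩
  filter_upwards [hK.eventually_exists (L := L ∪ W) (h1.union hW.isClosed)
    (h2.union w h3 hw hW.isPreconnected) hA.isOpen_compl
    (fun p hp hpA => disjoint_left.1 hdis hp hpA) isOpen_interior
    (by
      obtain ⟨p, hp⟩ := hW.interior_nonempty
      exact ⟨p, Or.inr (interior_subset hp), hp⟩) (Or.inl h4)]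
  rintro y ⟨K, k1, k2, k3, k4, p, k5, k6⟩
  exact (hW.joinedOff hWA hw (interior_subset k6)).trans
    ⟨K, k1, k2, k5, k3, disjoint_left.2 fun q hq hqA => k4 hq hqA⟩

/-- A point that can be joined off `A` to a fat continuum missing `A` lies in the interior of a
continuum missing `A`. -/
theorem KelleyProperty.exists_isFat_mem_interior [CompactSpace X] (hK : KelleyProperty X)
    {A W : Set X} (hA : IsClosed A) (hW : IsFat W) (hWA : Disjoint W A) {w z : X} (hw : w ∈ W)
    (hz : JoinedOff A w z) :
    ∃ K : Set X, IsFat K ∧ Disjoint K A ∧ z ∈ interior K := by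
  obtain ⟨L, h1, h2, h3, h4, h5⟩ := hz
  have hdis : Disjoint (L ∪ W) A := disjoint_union_left.2 ⟨h5, hWA⟩
  -- Thicken `A` to a closed neighbourhood that still misses `L ∪ W`.
  obtain ⟨V, hV, hAV, hVL⟩ := normal_exists_closure_subset hA (h1.union hW.isClosed).isOpen_compl
    (fun p hp hpL => disjoint_left.1 hdis hpL hp)
  have hWV : Disjoint W (closure V) := disjoint_left.2 fun p hp hpV => hVL hpV (Or.inr hp)
  have hopen := hK.isOpen_setOf_joinedOff isClosed_closure hW hWV hw
  have hzO : z ∈ {z | JoinedOff (closure V) w z} :=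
    ⟨L, h1, h2, h3, h4, disjoint_left.2 fun p hp hpV => hVL hpV (Or.inl hp)⟩
  have hzI : z ∈ interior (closure {z | JoinedOff (closure V) w z}) :=
    interior_maximal subset_closure hopen hzO
  refine ⟨closure {z | JoinedOff (closure V) w z},
    ⟨isClosed_closure, (isPreconnected_setOf_joinedOff _ w).closure, ⟨z, hzI⟩⟩, ?_, hzI⟩
  have : closure {z | JoinedOff (closure V) w z} ⊆ Vᶜ :=
    closure_minimal (fun p hp hpV => hp.right_notMem (subset_closure hpV)) hV.isClosed_compl
  exact disjoint_left.2 fun p hp hpA => this hp (hAV hpA)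

/-- If the points that can be joined off `A` to a fat continuum missing `A` are dense, then the
remaining points form a nonblocker. -/
theorem KelleyProperty.isNonblocker_compl [CompactSpace X] (hK : KelleyProperty X)
    {A W : Set X} (hA : IsClosed A) (hne : A.Nonempty) (hW : IsFat W) (hWA : Disjoint W A) {w : X}
    (hw : w ∈ W) (hd : Dense {z | JoinedOff A w z}) : IsNonblocker {z | ¬JoinedOff A w z} := by
  refine ⟨(hK.isOpen_setOf_joinedOff hA hW hWA hw).isClosed_compl, ?_, ?_, ?_⟩
  · obtain ⟨a, ha⟩ := hne
    exact ⟨a, fun h => h.right_notMem ha⟩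
  · intro h
    exact (h ▸ mem_univ w : w ∈ {z | ¬JoinedOff A w z}) (hW.joinedOff hWA hw hw)
  · intro x hx
    have hx : JoinedOff A w x := not_not.1 hx
    refine hd.mono fun z hz => ?_
    obtain ⟨L, h1, h2, h3, h4, h5⟩ := hx.symm.trans hz
    refine ⟨L, h1, h2, h3, h4, disjoint_left.2 fun p hp hpA => hpA ?_⟩
    exact hx.trans ⟨L, h1, h2, h3, hp, h5⟩

/-- Every proper fat continuum `W` is missed by a nonblocker. Among the closed sets `S` missing `W`
all of whose complementary points can be joined to `W` off `S`, take a minimal one. If its complement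
were not dense, the closure of the complement would be a continuum missing some point `q`, and the
set of points that cannot be joined to `W` off `{q}` would be smaller. -/
theorem KelleyProperty.exists_isNonblocker_disjoint [CompactSpace X] [ConnectedSpace X]
    (hK : KelleyProperty X) {W : Set X} (hW : IsFat W) (hne : W ≠ univ) :
    ∃ S, IsNonblocker S ∧ Disjoint W S := by
  obtain ⟨w, hw⟩ := hW.nonempty
  have mem : ∀ q, q ∉ W → {z | ¬JoinedOff {q} w z} ∈
      {S : Set X | IsClosed S ∧ S.Nonempty ∧ Disjoint W S ∧ ∀ z, z ∉ S → JoinedOff S w z} := by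
    intro q hq
    have hWq : Disjoint W {q} := disjoint_singleton_right.2 hq
    refine ⟨(hK.isOpen_setOf_joinedOff isClosed_singleton hW hWq hw).isClosed_compl,
      ⟨q, fun h => h.right_notMem rfl⟩,
      disjoint_left.2 fun p hp hpS => hpS (hW.joinedOff hWq hw hp), ?_⟩
    intro z hz
    obtain ⟨L, h1, h2, h3, h4, h5⟩ := not_not.1 hz
    exact ⟨L, h1, h2, h3, h4, disjoint_left.2 fun p hp hpS => hpS ⟨L, h1, h2, h3, hp, h5⟩⟩
  obtain ⟨q₀, hq₀⟩ := (ne_univ_iff_exists_notMem W).1 hne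
  obtain ⟨S, -, hS⟩ := zorn_superset_nonempty
    {S : Set X | IsClosed S ∧ S.Nonempty ∧ Disjoint W S ∧ ∀ z, z ∉ S → JoinedOff S w z}
    (by
      intro c hc hchain hcne
      have hcne' : Nonempty c := hcne.to_subtype
      refine ⟨⋂₀ c, ⟨isClosed_sInter fun A hA => (hc hA).1, ?_, ?_, ?_⟩,
        fun s hs => sInter_subset_of_mem hs⟩
      · refine IsCompact.nonempty_sInter_of_directed_nonempty_isCompact_isClosed ?_
          (fun A hA => (hc hA).2.1) (fun A hA => (hc hA).1.isCompact) (fun A hA => (hc hA).1)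
        intro A hA B hB
        rcases hchain.total hA hB with h | h
        · exact ⟨A, hA, Subset.rfl, h⟩
        · exact ⟨B, hB, h, Subset.rfl⟩
      · obtain ⟨A, hA⟩ := hcne
        exact (hc hA).2.2.1.mono_right (sInter_subset_of_mem hA)
      · intro z hz
        obtain ⟨A, hA, hzA⟩ : ∃ A ∈ c, z ∉ A := by simpa using hz
        exact ((hc hA).2.2.2 z hzA).mono (sInter_subset_of_mem hA))
    _ (mem q₀ hq₀)
  obtain ⟨hS1, hS2, hS3, hS4⟩ := hS.prop
  have hcompl : {z | ¬JoinedOff S w z} = S := by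
    ext z
    exact ⟨fun h => by_contra fun hz => h (hS4 z hz), fun hz h => h.right_notMem hz⟩
  refine ⟨S, hcompl ▸ hK.isNonblocker_compl hS1 hS2 hW hS3 hw ?_, hS3⟩
  by_contra hd
  obtain ⟨q, hq⟩ := (ne_univ_iff_exists_notMem _).1 (mt dense_iff_closure_eq.2 hd)
  have hOW : W ⊆ {z | JoinedOff S w z} := fun p hp => hW.joinedOff hS3 hw hp
  have hsub : {z | ¬JoinedOff {q} w z} ⊆ (closure {z | JoinedOff S w z})ᶜ := by
    intro z hz hzc
    exact hz ⟨closure {z | JoinedOff S w z}, isClosed_closure,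
      (isPreconnected_setOf_joinedOff S w).closure, subset_closure (hOW hw), hzc,
      disjoint_singleton_right.2 hq⟩
  have hle := hS.le_of_le (mem q fun h => hq (subset_closure (hOW h))) (by
    intro z hz
    by_contra hzS
    exact hsub hz (subset_closure (hS4 z hzS)))
  -- By minimality the open set of points joined to `W` off `S` is also closed.
  have hclosed : IsClosed {z | JoinedOff S w z} := by
    refine isClosed_of_closure_subset fun z hz => ?_
    by_contra hzO
    exact hsub (hle (hcompl ▸ hzO)) hz
  have huniv := IsClopen.eq_univ ⟨hclosed, hK.isOpen_setOf_joinedOff hS1 hW hS3 hw⟩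
    ⟨w, hOW hw⟩
  obtain ⟨s, hs⟩ := hS2
  exact (huniv ▸ mem_univ s : s ∈ {z | JoinedOff S w z}).right_notMem hs

/-- In a decomposable space the only closed connected set contained in no proper fat continuum is
the whole space. -/
theorem Decomposable.eq_univ_of_not_subset_isFat [CompactSpace X] (hdec : Decomposable X)
    {S : Set X} (hS : IsClosed S) (hSc : IsPreconnected S)
    (hfat : ∀ W : Set X, IsFat W → W ≠ univ → ¬S ⊆ W) : S = univ := by
  obtain ⟨M, hM, N, hN, hM1, hN1, hMN⟩ := hdec
  have hMfat : ∀ P Q : NonemptyCompacts X, P ∈ subcontinua X → (Q : Set X) ≠ univ →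
      (P : Set X) ∪ Q = univ → IsFat (P : Set X) := by
    intro P Q hP hQ hPQ
    refine ⟨P.isCompact.isClosed, IsConnected.isPreconnected hP, ?_⟩
    obtain ⟨q, hq⟩ := (ne_univ_iff_exists_notMem _).1 hQ
    refine ⟨q, interior_maximal (s := (P : Set X)) (t := (Q : Set X)ᶜ) ?_
      Q.isCompact.isClosed.isOpen_compl hq⟩
    intro p hp
    exact (hPQ ▸ mem_univ p : p ∈ (P : Set X) ∪ Q).resolve_right hp
  have hMf := hMfat M N hM hN1 hMN
  have hNf := hMfat N M hN hM1 (by rw [union_comm]; exact hMN)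
  obtain ⟨p, hpS, hpN⟩ := not_subset.1 (hfat N hNf hN1)
  have hpM : p ∈ (M : Set X) := (hMN ▸ mem_univ p : p ∈ (M : Set X) ∪ N).resolve_right hpN
  -- `M ∪ S` is a fat continuum containing `S`, so it is `X`, and `S` contains the complement of `M`.
  have hMS : (M : Set X) ∪ S = univ := by
    by_contra hne
    refine hfat ((M : Set X) ∪ S) ⟨hMf.isClosed.union hS, ?_, ?_⟩ hne subset_union_right
    · exact hMf.isPreconnected.union p hpM hpS hSc
    · exact hMf.interior_nonempty.mono (interior_mono subset_union_left)
  have hsub : (M : Set X)ᶜ ⊆ S := fun q hq =>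
    (hMS ▸ mem_univ q : q ∈ (M : Set X) ∪ S).resolve_left hq
  by_contra hne
  obtain ⟨q, hq⟩ := (ne_univ_iff_exists_notMem _).1 hM1
  exact hfat S ⟨hS, hSc, q, interior_maximal hsub hMf.isClosed.isOpen_compl hq⟩ hne Subset.rfl

/-! ### Every point lies in a nonblocker -/

theorem isClosed_sUnion_isNonblocker [CompactSpace X] (hNB : IsCompact (NB X)) :
    IsClosed (⋃₀ {A : Set X | IsNonblocker A}) := by
  convert (NonemptyCompacts.isCompact_biUnion_coe_of_isCompact hNB).isClosed using 1
  ext x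
  simp only [mem_sUnion, mem_ofPred_eq, mem_iUnion, SetLike.mem_coe, exists_prop]
  constructor
  · rintro ⟨A, hA, hx⟩
    obtain ⟨K, hK, rfl⟩ := hA.exists_mem_NB
    exact ⟨K, hK, hx⟩
  · rintro ⟨K, hK, hx⟩
    exact ⟨K, (mem_NB_iff K).1 hK, hx⟩

/-- The union of all nonblockers is connected: a separation of the union into closed sets `P` and
`Q` would split the connected hyperspace `NB X` into the open families of the nonblockers contained
in `P` and of those meeting `Q`. -/
theorem isPreconnected_sUnion_isNonblocker [CompactSpace X] [ConnectedSpace X]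
    (hNB : IsContinuum (NB X)) : IsPreconnected (⋃₀ {A : Set X | IsNonblocker A}) := by
  have hY := isClosed_sUnion_isNonblocker hNB.1
  set Y := ⋃₀ {A : Set X | IsNonblocker A}
  rw [isPreconnected_closed_iff]
  rintro t t' ht ht' hYt ⟨p, hpY, hpt⟩ ⟨q, hqY, hqt'⟩
  by_contra hne
  have hdis : Disjoint (Y ∩ t) (Y ∩ t') :=
    disjoint_left.2 fun z hz hz' => hne ⟨z, hz.1, hz.2, hz'.2⟩
  have hsub : ∀ A : Set X, IsNonblocker A → A ⊆ Y := fun A hA => subset_sUnion_of_mem hA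
  obtain ⟨A, hA, hpA⟩ := hpY
  obtain ⟨B, hB, hqB⟩ := hqY
  have hAt : IsNonblocker (A ∩ t) := by
    refine IsNonblocker.of_union (Q := A ∩ t') ?_ (hA.isClosed.inter ht) (hA.isClosed.inter ht')
      (hdis.mono (inter_subset_inter_left _ (hsub A hA)) (inter_subset_inter_left _ (hsub A hA)))
      ⟨p, hpA, hpt⟩
    rw [← inter_union_distrib_left, inter_eq_left.2 ((hsub A hA).trans hYt)]
    exact hA
  obtain ⟨K, hKNB, hKA⟩ := hAt.exists_mem_NB
  obtain ⟨K', hK'NB, hK'B⟩ := hB.exists_mem_NB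
  obtain ⟨C, hC, hC1, z, hzC, hz⟩ := hNB.2.isPreconnected
    {C | (C : Set X) ⊆ (Y ∩ t')ᶜ} {C | ((C : Set X) ∩ (Y ∩ t)ᶜ).Nonempty}
    (NonemptyCompacts.isOpen_subsets_of_isOpen (hY.inter ht').isOpen_compl)
    (NonemptyCompacts.isOpen_inter_nonempty_of_isOpen (hY.inter ht).isOpen_compl)
    (by
      intro C hC
      by_cases h : (C : Set X) ⊆ Y ∩ t
      · exact Or.inl fun z hz => disjoint_left.1 hdis (h hz)
      · obtain ⟨z, hz, hz'⟩ := not_subset.1 h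
        exact Or.inr ⟨z, hz, hz'⟩)
    ⟨K, hKNB, fun z hz => disjoint_left.1 hdis (by
      rw [hKA] at hz
      exact ⟨hsub A hA hz.1, hz.2⟩)⟩
    ⟨K', hK'NB, q, hK'B ▸ hqB, fun h => hne ⟨q, h.1, h.2, hqt'⟩⟩
  have hzY : z ∈ Y := hsub C ((mem_NB_iff C).1 hC) hzC
  exact (hYt hzY).elim (fun h => hz ⟨hzY, h⟩) (fun h => hC1 hzC ⟨hzY, h⟩)

theorem exists_isNonblocker_mem [CompactSpace X] [ConnectedSpace X] (hdec : Decomposable X)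
    (hK : KelleyProperty X) (hNB : IsContinuum (NB X)) (x : X) :
    ∃ A : Set X, IsNonblocker A ∧ x ∈ A := by
  have : ⋃₀ {A : Set X | IsNonblocker A} = univ := by
    refine hdec.eq_univ_of_not_subset_isFat (isClosed_sUnion_isNonblocker hNB.1)
      (isPreconnected_sUnion_isNonblocker hNB) fun W hW hne hsub => ?_
    obtain ⟨S, hS, hWS⟩ := hK.exists_isNonblocker_disjoint hW hne
    obtain ⟨p, hp⟩ := hS.nonempty
    exact disjoint_right.1 hWS hp (hsub ⟨S, hS, hp⟩)
  obtain ⟨A, hA, hx⟩ := (this ▸ mem_univ x : x ∈ ⋃₀ {A : Set X | IsNonblocker A})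
  exact ⟨A, hA, hx⟩

/-! ### The smallest nonblocker containing a point -/

theorem minNB_eq_sInter [CompactSpace X] {x : X} (h : ∃ A : Set X, IsNonblocker A ∧ x ∈ A) :
    minNB x = ⋂₀ {A : Set X | IsNonblocker A ∧ x ∈ A} := by
  have h' : ∃ A ∈ NB X, x ∈ A := by
    obtain ⟨A, hA, hx⟩ := h
    obtain ⟨K, hK, rfl⟩ := hA.exists_mem_NB
    exact ⟨K, hK, hx⟩
  rw [minNB, if_pos h']
  ext z
  constructor
  · rintro hz A ⟨hA, hx⟩
    obtain ⟨K, hK, rfl⟩ := hA.exists_mem_NB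
    exact hz K hK hx
  · exact fun hz A hA hx => hz A ⟨(mem_NB_iff A).1 hA, hx⟩

theorem minNB_subset [CompactSpace X] {x : X} {A : Set X} (hA : IsNonblocker A) (hx : x ∈ A) :
    minNB x ⊆ A := by
  rw [minNB_eq_sInter ⟨A, hA, hx⟩]
  exact sInter_subset_of_mem ⟨hA, hx⟩

theorem mem_minNB_self (x : X) : x ∈ minNB x := by
  unfold minNB
  split_ifs
  · exact fun A _ hx => hx
  · exact mem_univ x

theorem isNonblocker_minNB [CompactSpace X] {x : X} (h : ∃ A : Set X, IsNonblocker A ∧ x ∈ A) :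
    IsNonblocker (minNB x) := by
  have hx := mem_minNB_self x
  rw [minNB_eq_sInter h] at hx ⊢
  exact IsNonblocker.sInter (fun A hA => hA.1) h ⟨x, hx⟩

theorem minNB_subset_minNB [CompactSpace X] (hcov : ∀ x : X, ∃ A : Set X, IsNonblocker A ∧ x ∈ A)
    {x y : X} (hy : y ∈ minNB x) : minNB y ⊆ minNB x :=
  minNB_subset (isNonblocker_minNB (hcov x)) hy

/-- A fat continuum that misses `x` misses `π(x)`. Indeed the points that can be joined to it off
`{x}` are dense: a point outside `π(x)` can be joined off `π(x)` to a dense set of points. -/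
theorem KelleyProperty.disjoint_minNB [CompactSpace X] (hK : KelleyProperty X)
    (hcov : ∀ x : X, ∃ A : Set X, IsNonblocker A ∧ x ∈ A) {W : Set X} (hW : IsFat W) {x : X}
    (hx : x ∉ W) : Disjoint W (minNB x) := by
  obtain ⟨w, hw⟩ := hW.nonempty
  have hWx : Disjoint W {x} := disjoint_singleton_right.2 hx
  have hπ := isNonblocker_minNB (hcov x)
  have hopen := hK.isOpen_setOf_joinedOff isClosed_singleton hW hWx hw
  have hd : Dense {z | JoinedOff {x} w z} := by
    refine hπ.dense_compl.mono fun q hq => ?_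
    obtain ⟨z, hwz, hqz⟩ := (hπ.dense q hq).inter_open_nonempty _ hopen
      ⟨w, hW.joinedOff hWx hw hw⟩
    exact JoinedOff.trans hwz
      (JoinedOff.mono hqz (singleton_subset_iff.2 (mem_minNB_self x))).symm
  have hS := hK.isNonblocker_compl isClosed_singleton (singleton_nonempty x) hW hWx hw hd
  refine disjoint_left.2 fun p hp hpx => ?_
  exact minNB_subset hS (fun h => h.right_notMem rfl) hpx (hW.joinedOff hWx hw hp)

theorem KelleyProperty.joinedOff_minNB [CompactSpace X] (hK : KelleyProperty X)
    (hcov : ∀ x : X, ∃ A : Set X, IsNonblocker A ∧ x ∈ A) {W : Set X} (hW : IsFat W) {x w z : X}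
    (hx : x ∉ W) (hw : w ∈ W) (hz : z ∉ minNB x) : JoinedOff (minNB x) w z := by
  obtain ⟨p, hp, hzp⟩ := ((isNonblocker_minNB (hcov x)).dense z hz).inter_open_nonempty _
    isOpen_interior hW.interior_nonempty
  exact (hW.joinedOff (hK.disjoint_minNB hcov hW hx) hw (interior_subset hp)).trans
    (JoinedOff.symm hzp)

/-! ### Fat continua missing a given point -/

/-- Let `K` be a fat continuum. Finitely many points outside `K` lying in different components of
the complement of the interior of `K` are contained in a common nonblocker: by boundary bumping
a continuum joining `z` to `K` can be cut down to the component of `z`, where it has to avoid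
only one of the points. -/
theorem KelleyProperty.exists_isNonblocker_superset [CompactSpace X] (hK : KelleyProperty X)
    [ConnectedSpace X] (hcov : ∀ x : X, ∃ A : Set X, IsNonblocker A ∧ x ∈ A) {K R : Set X}
    (hKf : IsFat K) (hR : R.Finite) (hne : R.Nonempty) (hRK : Disjoint K R)
    (hcomp : ∀ x ∈ R, ∀ y ∈ R, y ∈ connectedComponentIn (univ \ interior K) x → x = y) :
    ∃ A, IsNonblocker A ∧ R ⊆ A := by
  obtain ⟨k, hk⟩ := hKf.nonempty
  refine ⟨_, hK.isNonblocker_compl hR.isClosed hne hKf hRK hk ?_,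
    fun x hx h => h.right_notMem hx⟩
  have hπ : ∀ x ∈ R, IsClosed (minNB x) ∧ Dense (minNB x)ᶜ := fun x _ =>
    ⟨(isNonblocker_minNB (hcov x)).isClosed, (isNonblocker_minNB (hcov x)).dense_compl⟩
  have hd : Dense (⋂ x ∈ R, (minNB x)ᶜ) :=
    dense_biInter_of_isOpen (fun x hx => (hπ x hx).1.isOpen_compl) hR.countable
      (fun x hx => (hπ x hx).2)
  refine hd.mono fun z hz => ?_
  rw [mem_iInter₂] at hz
  by_cases hzK : z ∈ K
  · exact hKf.joinedOff hRK hk hzK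
  have hzI : z ∉ interior K := fun h => hzK (interior_subset h)
  obtain ⟨J, hJ, hJc, hkJ, hzJ, hJR⟩ : ∃ J : Set X, IsClosed J ∧ IsPreconnected J ∧
      (J ∩ interior K).Nonempty ∧ z ∈ J ∧
      Disjoint (J ∩ connectedComponentIn (univ \ interior K) z) R := by
    obtain ⟨i, hi⟩ := hKf.interior_nonempty
    by_cases h : ∃ x ∈ R, x ∈ connectedComponentIn (univ \ interior K) z
    · obtain ⟨x, hxR, hxz⟩ := h
      obtain ⟨J, h1, h2, h3, h4, h5⟩ := hK.joinedOff_minNB hcov hKf (disjoint_right.1 hRK hxR)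
        (interior_subset hi) (hz x hxR)
      refine ⟨J, h1, h2, ⟨i, h3, hi⟩, h4, disjoint_left.2 ?_⟩
      rintro y ⟨hyJ, hyz⟩ hyR
      rw [connectedComponentIn_eq hxz] at hyz
      rw [← hcomp x hxR y hyR hyz] at hyJ
      exact disjoint_left.1 h5 hyJ (mem_minNB_self x)
    · refine ⟨univ, isClosed_univ, isPreconnected_univ, ⟨i, mem_univ i, hi⟩, mem_univ z,
        disjoint_left.2 fun y hy hyR => h ⟨y, hyR, hy.2⟩⟩
  obtain ⟨y, hy, hyK⟩ :=
    connectedComponentIn_diff_inter_closure_nonempty hJ hJc isOpen_interior hkJ hzJ hzI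
  have hyK' : y ∈ K := closure_minimal interior_subset hKf.isClosed hyK
  refine JoinedOff.trans (hKf.joinedOff hRK hk hyK') ⟨connectedComponentIn (J \ interior K) z,
    isClosed_connectedComponentIn (hJ.sdiff isOpen_interior) z, isPreconnected_connectedComponentIn,
    hy, mem_connectedComponentIn ⟨hzJ, hzI⟩, hJR.mono_left (subset_inter ?_ ?_)⟩
  · exact (connectedComponentIn_subset _ _).trans sdiff_subset
  · exact connectedComponentIn_mono z (sdiff_subset_sdiff_left (subset_univ J))

/-- If all components of the complement of the interior of a fat continuum `K ≠ X` had empty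
interior, finite subsets of `Kᶜ` with points in different components would be dense enough for a
nonblocker containing all of `Kᶜ` to arise as a limit; but nonblockers have empty interior. -/
theorem KelleyProperty.exists_isFat_disjoint_interior [CompactSpace X] (hK : KelleyProperty X)
    [ConnectedSpace X] (hNB : IsCompact (NB X))
    (hcov : ∀ x : X, ∃ A : Set X, IsNonblocker A ∧ x ∈ A) {K : Set X} (hKf : IsFat K)
    (hne : K ≠ univ) : ∃ D, IsFat D ∧ Disjoint D (interior K) := by
  by_contra hno
  have hint : ∀ x, interior (connectedComponentIn (univ \ interior K) x) = ∅ := by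
    intro x
    by_contra h
    refine hno ⟨_, ⟨isClosed_connectedComponentIn (isClosed_univ.sdiff isOpen_interior) x,
      isPreconnected_connectedComponentIn, nonempty_iff_ne_empty.2 h⟩,
      disjoint_left.2 fun p hp => (connectedComponentIn_subset _ _ hp).2⟩
  have hfin : ∀ s : Finset {G : Set X // IsOpen G ∧ G.Nonempty ∧ Disjoint K G},
      ∃ R : Set X, R.Finite ∧ Disjoint K R ∧
      (∀ x ∈ R, ∀ y ∈ R, y ∈ connectedComponentIn (univ \ interior K) x → x = y) ∧
      ∀ G ∈ s, (R ∩ G).Nonempty := by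
    classical
    intro s
    induction s using Finset.induction_on with
    | empty => exact ⟨∅, finite_empty, disjoint_empty K, by simp, by simp⟩
    | insert G s _ ih =>
      obtain ⟨R, hR, hRK, hcomp, hRs⟩ := ih
      have hd : Dense (⋂ x ∈ R, (connectedComponentIn (univ \ interior K) x)ᶜ) :=
        dense_biInter_of_isOpen
          (fun x _ => (isClosed_connectedComponentIn
            (isClosed_univ.sdiff isOpen_interior) x).isOpen_compl) hR.countable
          (fun x _ => interior_eq_empty_iff_dense_compl.1 (hint x))
      obtain ⟨g, hgG, hg⟩ := hd.inter_open_nonempty _ G.2.1 G.2.2.1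
      rw [mem_iInter₂] at hg
      have hgK : g ∉ K := fun h => disjoint_left.1 G.2.2.2 h hgG
      have hgI : g ∈ univ \ interior K := ⟨mem_univ g, fun h => hgK (interior_subset h)⟩
      refine ⟨insert g R, hR.insert g, ?_, ?_, ?_⟩
      · rw [insert_eq]
        exact disjoint_union_right.2 ⟨disjoint_singleton_right.2 hgK, hRK⟩
      · rintro x (rfl | hx) y (rfl | hy) hxy
        · rfl
        · refine absurd ?_ (hg y hy)
          rw [← connectedComponentIn_eq hxy]
          exact mem_connectedComponentIn hgI
        · exact absurd hxy (hg x hx)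
        · exact hcomp x hx y hy hxy
      · intro G' hG'
        rcases Finset.mem_insert.1 hG' with rfl | hG'
        · exact ⟨g, mem_insert g R, hgG⟩
        · exact (hRs G' hG').mono (inter_subset_inter_left _ (subset_insert g R))
  have hKo : IsOpen Kᶜ := hKf.isClosed.isOpen_compl
  obtain ⟨q, hq⟩ := (ne_univ_iff_exists_notMem K).1 hne
  obtain ⟨A, hA, hAG⟩ := hNB.inter_iInter_nonempty
    (fun G : {G : Set X // IsOpen G ∧ G.Nonempty ∧ Disjoint K G} =>
      {A : NonemptyCompacts X | ((A : Set X) ∩ closure G).Nonempty})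
    (fun G => NonemptyCompacts.isClosed_inter_nonempty_of_isClosed isClosed_closure)
    (by
      intro s
      classical
      obtain ⟨R, hR, hRK, hcomp, hRs⟩ :=
        hfin (insert ⟨Kᶜ, hKo, ⟨q, hq⟩, disjoint_compl_right⟩ s)
      obtain ⟨B, hB, hRB⟩ := hK.exists_isNonblocker_superset hcov hKf hR
        ((hRs _ (Finset.mem_insert_self _ _)).mono inter_subset_left) hRK hcomp
      obtain ⟨L, hL, rfl⟩ := hB.exists_mem_NB
      refine ⟨L, hL, mem_iInter₂.2 fun G hG => ?_⟩
      exact (hRs G (Finset.mem_insert_of_mem hG)).mono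
        (inter_subset_inter hRB subset_closure))
  have hAn := (mem_NB_iff A).1 hA
  have hsub : Kᶜ ⊆ (A : Set X) := by
    intro p hp
    by_contra hpA
    obtain ⟨V, hV, hpV, hVA⟩ := normal_exists_closure_subset isClosed_singleton
      (hKo.inter hAn.isClosed.isOpen_compl) (singleton_subset_iff.2 ⟨hp, hpA⟩)
    obtain ⟨a, ha, haV⟩ := mem_iInter.1 hAG ⟨V, hV, ⟨p, hpV rfl⟩,
      disjoint_right.2 fun v hv => (hVA (subset_closure hv)).1⟩
    exact (hVA haV).2 ha
  have hqi : q ∈ interior (A : Set X) := interior_maximal hsub hKo hq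
  rw [hAn.interior_eq_empty] at hqi
  exact hqi

theorem Decomposable.exists_isFat_notMem [CompactSpace X] [ConnectedSpace X]
    (hdec : Decomposable X) (hK : KelleyProperty X) (hNB : IsCompact (NB X))
    (hcov : ∀ x : X, ∃ A : Set X, IsNonblocker A ∧ x ∈ A) (q : X) : ∃ W, IsFat W ∧ q ∉ W := by
  obtain ⟨M, hM, hM1, hqM⟩ : ∃ M : Set X, IsFat M ∧ M ≠ univ ∧ q ∈ M := by
    by_contra hno
    have : Subsingleton X := by
      have := hdec.eq_univ_of_not_subset_isFat (S := {q}) isClosed_singleton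
        isPreconnected_singleton fun W hW hne hq => hno ⟨W, hW, hne, hq rfl⟩
      exact subsingleton_of_univ_subsingleton (this ▸ subsingleton_singleton)
    obtain ⟨A, hA, hqA⟩ := hcov q
    exact hA.ne_univ (hA.nonempty.eq_univ)
  obtain ⟨p, hp⟩ := (ne_univ_iff_exists_notMem M).1 hM1
  have hMp : Disjoint M {p} := disjoint_singleton_right.2 hp
  -- Enlarge `M` to a proper fat continuum with `q` in its interior.
  obtain ⟨K, hKf, hKp, hqK⟩ := hK.exists_isFat_mem_interior isClosed_singleton hM hMp hqM
    (hM.joinedOff hMp hqM hqM)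
  obtain ⟨D, hD, hDK⟩ := hK.exists_isFat_disjoint_interior hNB hcov hKf
    (fun h => disjoint_right.1 hKp rfl (h ▸ mem_univ p))
  exact ⟨D, hD, fun h => disjoint_left.1 hDK h hqK⟩

/-! ### Continuity of `π` -/

/-- Upper semicontinuity of `π`, as closedness of its graph: a point outside `π(x)` is interior to
a fat continuum missing `x`, and this continuum misses `π(x')` for all `x'` near `x`. -/
theorem isClosed_setOf_mem_minNB [CompactSpace X] [ConnectedSpace X] (hdec : Decomposable X)
    (hK : KelleyProperty X) (hNB : IsCompact (NB X))
    (hcov : ∀ x : X, ∃ A : Set X, IsNonblocker A ∧ x ∈ A) :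
    IsClosed {p : X × X | p.2 ∈ minNB p.1} := by
  rw [← isOpen_compl_iff, isOpen_iff_mem_nhds]
  rintro ⟨x, z⟩ (hz : z ∉ minNB x)
  obtain ⟨W, hW, hxW⟩ := hdec.exists_isFat_notMem hK hNB hcov x
  obtain ⟨w, hw⟩ := hW.nonempty
  obtain ⟨L, hL, hLx, hzL⟩ := hK.exists_isFat_mem_interior
    (isNonblocker_minNB (hcov x)).isClosed hW (hK.disjoint_minNB hcov hW hxW) hw
    (hK.joinedOff_minNB hcov hW hxW hw hz)
  have hxL : x ∈ Lᶜ := disjoint_right.1 hLx (mem_minNB_self x)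
  filter_upwards [prod_mem_nhds (hL.isClosed.isOpen_compl.mem_nhds hxL)
    (isOpen_interior.mem_nhds hzL)]
  rintro ⟨x', z'⟩ ⟨hx', hz'⟩ h
  exact disjoint_left.1 (hK.disjoint_minNB hcov hL hx') (interior_subset hz') h

theorem isClosed_setOf_minNB_inter_nonempty [CompactSpace X]
    (hR : IsClosed {p : X × X | p.2 ∈ minNB p.1}) {F : Set X} (hF : IsClosed F) :
    IsClosed {x : X | (minNB x ∩ F).Nonempty} := by
  convert isClosedMap_fst_of_compactSpace _ (hR.inter (hF.preimage continuous_snd)) using 1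
  ext x
  constructor
  · rintro ⟨z, hz, hzF⟩
    exact ⟨(x, z), ⟨hz, hzF⟩, rfl⟩
  · rintro ⟨⟨x', z⟩, ⟨hz, hzF⟩, rfl⟩
    exact ⟨z, hz, hzF⟩

/-- Lower semicontinuity of `π`: the points `x` for which `π(x)` misses the open set `G` are the
points of the nonblockers missing `G`, and these nonblockers form a compact family. -/
theorem isOpen_setOf_minNB_inter_nonempty [CompactSpace X] (hNB : IsCompact (NB X))
    (hcov : ∀ x : X, ∃ A : Set X, IsNonblocker A ∧ x ∈ A) {G : Set X} (hG : IsOpen G) :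
    IsOpen {x : X | (minNB x ∩ G).Nonempty} := by
  rw [← isClosed_compl_iff]
  convert (NonemptyCompacts.isCompact_biUnion_coe_of_isCompact (hNB.inter_right
    (NonemptyCompacts.isClosed_subsets_of_isClosed hG.isClosed_compl))).isClosed using 1
  ext x
  simp only [mem_iUnion, SetLike.mem_coe, exists_prop]
  constructor
  · intro hx
    obtain ⟨A, hA, hAx⟩ := (isNonblocker_minNB (hcov x)).exists_mem_NB
    refine ⟨A, ⟨hA, fun z hz hzG => hx ⟨z, hAx ▸ hz, hzG⟩⟩, ?_⟩
    have := mem_minNB_self x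
    rw [← hAx] at this
    exact this
  · rintro ⟨A, ⟨hA, hAG⟩, hx⟩ ⟨z, hz, hzG⟩
    exact hAG (minNB_subset ((mem_NB_iff A).1 hA) hx hz) hzG

/-! ### Minimality of the sets `π(x)` -/

/-- The points `x` for which `π(x)` is minimal among the sets `π(y)`. -/
def minimalPoints (X : Type*) [MetricSpace X] : Set X :=
  {x | ∀ y ∈ minNB x, x ∈ minNB y}

theorem minNB_eq_of_mem_minimalPoints [CompactSpace X]
    (hcov : ∀ x : X, ∃ A : Set X, IsNonblocker A ∧ x ∈ A) {x y : X} (hx : x ∈ minimalPoints X)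
    (hy : y ∈ minNB x) : minNB y = minNB x :=
  (minNB_subset_minNB hcov hy).antisymm (minNB_subset_minNB hcov (hx y hy))

theorem mem_minimalPoints_of_mem_minNB [CompactSpace X]
    (hcov : ∀ x : X, ∃ A : Set X, IsNonblocker A ∧ x ∈ A) {x y : X} (hx : x ∈ minimalPoints X)
    (hy : y ∈ minNB x) : y ∈ minimalPoints X := by
  intro z hz
  rw [minNB_eq_of_mem_minimalPoints hcov hx hy] at hz
  rw [minNB_eq_of_mem_minimalPoints hcov hx hz]
  exact hy

theorem IsNonblocker.inter_minimalPoints_nonempty [CompactSpace X] {A : Set X}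
    (hA : IsNonblocker A) : (A ∩ minimalPoints X).Nonempty := by
  obtain ⟨S, hSA, hS⟩ := zorn_superset_nonempty {S : Set X | IsNonblocker S}
    (by
      intro c hc hchain hcne
      have hcne' : Nonempty c := hcne.to_subtype
      refine ⟨⋂₀ c, IsNonblocker.sInter hc hcne ?_, fun s hs => sInter_subset_of_mem hs⟩
      refine IsCompact.nonempty_sInter_of_directed_nonempty_isCompact_isClosed ?_
        (fun A hA => (hc hA).nonempty) (fun A hA => (hc hA).isClosed.isCompact)
        (fun A hA => (hc hA).isClosed)
      intro A hA B hB
      rcases hchain.total hA hB with h | h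
      · exact ⟨A, hA, Subset.rfl, h⟩
      · exact ⟨B, hB, h, Subset.rfl⟩)
    A hA
  obtain ⟨x, hx⟩ := hS.prop.nonempty
  refine ⟨x, hSA hx, fun y hy => ?_⟩
  have hyS : y ∈ S := minNB_subset hS.prop hx hy
  exact hS.le_of_le (isNonblocker_minNB ⟨S, hS.prop, hyS⟩) (minNB_subset hS.prop hyS) hx

theorem isClosed_minimalPoints [CompactSpace X] (hNB : IsCompact (NB X))
    (hcov : ∀ x : X, ∃ A : Set X, IsNonblocker A ∧ x ∈ A)
    (hR : IsClosed {p : X × X | p.2 ∈ minNB p.1}) : IsClosed (minimalPoints X) := by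
  rw [← isOpen_compl_iff, isOpen_iff_mem_nhds]
  intro x hx
  obtain ⟨y, hyx, hxy⟩ : ∃ y ∈ minNB x, x ∉ minNB y := by
    simpa [minimalPoints] using hx
  have hnhds : {p : X × X | p.2 ∈ minNB p.1}ᶜ ∈ 𝓝 (y, x) := hR.isOpen_compl.mem_nhds hxy
  obtain ⟨V, U, hV, hyV, hU, hxU, hVU⟩ := mem_nhds_prod_iff'.1 hnhds
  filter_upwards [hU.mem_nhds hxU,
    (isOpen_setOf_minNB_inter_nonempty hNB hcov hV).mem_nhds ⟨y, hyx, hyV⟩]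
  rintro x' hx' ⟨y', hy', hyV'⟩ h
  exact hVU (mk_mem_prod hyV' hx') (h y' hy')

/-- For a separation of the set of minimal points into closed sets `P` and `Q`, the set of all `x`
for which `π(x)` meets `P` would be open and closed, hence all of `X`; but `π(x) ⊆ Q` for
`x ∈ Q`. -/
theorem isPreconnected_minimalPoints [CompactSpace X] [ConnectedSpace X] (hNB : IsCompact (NB X))
    (hcov : ∀ x : X, ∃ A : Set X, IsNonblocker A ∧ x ∈ A)
    (hR : IsClosed {p : X × X | p.2 ∈ minNB p.1}) : IsPreconnected (minimalPoints X) := by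
  have hE := isClosed_minimalPoints hNB hcov hR
  rw [isPreconnected_closed_iff]
  rintro t t' ht ht' hEt ⟨p, hpE, hpt⟩ ⟨q, hqE, hqt'⟩
  by_contra hne
  have hdis : Disjoint (minimalPoints X ∩ t) (minimalPoints X ∩ t') :=
    disjoint_left.2 fun z hz hz' => hne ⟨z, hz.1, hz.2, hz'.2⟩
  have hP := isClosed_setOf_minNB_inter_nonempty hR (hE.inter ht)
  have hQ := isClosed_setOf_minNB_inter_nonempty hR (hE.inter ht')
  have hsubE : ∀ y ∈ minimalPoints X, minNB y ⊆ minimalPoints X := fun y hy z hz =>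
    mem_minimalPoints_of_mem_minNB hcov hy hz
  -- Closed pieces of a nonblocker being nonblockers, `π(y)` lies on one side of the separation.
  have hside : ∀ s s' : Set X, IsClosed s → IsClosed s' → minimalPoints X ⊆ s ∪ s' →
      Disjoint (minimalPoints X ∩ s) (minimalPoints X ∩ s') →
      ∀ y ∈ minimalPoints X, y ∈ s → minNB y ⊆ s := by
    intro s s' hs hs' hss hd y hy hys
    have hπ := isNonblocker_minNB (hcov y)
    have : IsNonblocker (minNB y ∩ s) := by
      refine IsNonblocker.of_union (Q := minNB y ∩ s') ?_ (hπ.isClosed.inter hs)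
        (hπ.isClosed.inter hs') (hd.mono (inter_subset_inter_left _ (hsubE y hy))
          (inter_subset_inter_left _ (hsubE y hy))) ⟨y, mem_minNB_self y, hys⟩
      rw [← inter_union_distrib_left, inter_eq_left.2 ((hsubE y hy).trans hss)]
      exact hπ
    exact (minNB_subset this ⟨mem_minNB_self y, hys⟩).trans inter_subset_right
  have hPopen : IsOpen {x : X | (minNB x ∩ (minimalPoints X ∩ t)).Nonempty} := by
    rw [isOpen_iff_mem_nhds]
    rintro x ⟨y, hyx, hyE, hyt⟩
    have hyQ : y ∈ {x : X | (minNB x ∩ (minimalPoints X ∩ t')).Nonempty}ᶜ := by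
      rintro ⟨z, hz, hzE, hzt'⟩
      exact hne ⟨z, hzE, hside t t' ht ht' hEt hdis y hyE hyt hz, hzt'⟩
    filter_upwards [(isOpen_setOf_minNB_inter_nonempty hNB hcov hQ.isOpen_compl).mem_nhds
      ⟨y, hyx, hyQ⟩]
    rintro x' ⟨y', hy', hyQ'⟩
    obtain ⟨z, hz, hzE⟩ := (isNonblocker_minNB (hcov y')).inter_minimalPoints_nonempty
    exact ⟨z, minNB_subset_minNB hcov hy' hz, hzE,
      (hEt hzE).resolve_right fun h => hyQ' ⟨z, hz, hzE, h⟩⟩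
  have huniv := IsClopen.eq_univ ⟨hP, hPopen⟩ ⟨p, p, mem_minNB_self p, hpE, hpt⟩
  obtain ⟨z, hz, hzE, hzt⟩ :=
    (huniv ▸ mem_univ q : q ∈ {x : X | (minNB x ∩ (minimalPoints X ∩ t)).Nonempty})
  exact hne ⟨z, hzE, hzt, hside t' t ht' ht (by rwa [union_comm]) hdis.symm q hqE hqt' hz⟩

/-- All sets `π(x)` are minimal: the set of minimal points is closed and connected, and every proper
fat continuum misses one of its points. -/
theorem minimalPoints_eq_univ [CompactSpace X] [ConnectedSpace X] (hdec : Decomposable X)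
    (hK : KelleyProperty X) (hNB : IsCompact (NB X))
    (hcov : ∀ x : X, ∃ A : Set X, IsNonblocker A ∧ x ∈ A) : minimalPoints X = univ := by
  have hR := isClosed_setOf_mem_minNB hdec hK hNB hcov
  refine hdec.eq_univ_of_not_subset_isFat (isClosed_minimalPoints hNB hcov hR)
    (isPreconnected_minimalPoints hNB hcov hR) fun W hW hne hsub => ?_
  obtain ⟨x, hx⟩ := (ne_univ_iff_exists_notMem W).1 hne
  obtain ⟨y, hy, hyE⟩ := (isNonblocker_minNB (hcov x)).inter_minimalPoints_nonempty
  exact disjoint_left.1 (hK.disjoint_minNB hcov hW hx) (hsub hyE) hy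

/-! ### The decomposition -/

theorem isContinuousDecomposition_familyL [CompactSpace X] (hNB : IsCompact (NB X))
    (hcov : ∀ x : X, ∃ A : Set X, IsNonblocker A ∧ x ∈ A)
    (hR : IsClosed {p : X × X | p.2 ∈ minNB p.1})
    (hπ : ∀ x y : X, y ∈ minNB x → minNB y = minNB x) :
    IsContinuousDecomposition (familyL X) := by
  refine ⟨⟨?_, fun a => ⟨minNB a, ⟨⟨a, rfl⟩, mem_minNB_self a⟩, ?_⟩⟩, ?_, ?_⟩
  · rintro ⟨x, hx⟩
    exact (hx ▸ mem_minNB_self x : x ∈ (∅ : Set X))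
  · rintro S ⟨⟨x, rfl⟩, ha⟩
    exact (hπ x a ha).symm
  · rintro D ⟨x, rfl⟩ U hU hDU
    refine ⟨{z | (minNB z ∩ Uᶜ).Nonempty}ᶜ,
      (isClosed_setOf_minNB_inter_nonempty hR hU.isClosed_compl).isOpen_compl, ?_, ?_⟩
    · rintro z hz ⟨y, hy, hyU⟩
      rw [hπ x z hz] at hy
      exact hyU (hDU hy)
    · rintro A ⟨a, rfl⟩ ⟨v, hva, hv⟩ y hy
      rw [← hπ a v hva] at hy
      exact by_contra fun hyU => hv ⟨y, hy, hyU⟩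
  · rintro D ⟨d, rfl⟩ x hx y hy U hU hxU
    refine ⟨{z | (minNB z ∩ U).Nonempty}, isOpen_setOf_minNB_inter_nonempty hNB hcov hU, ?_, ?_⟩
    · refine ⟨x, ?_, hxU⟩
      rw [hπ d y hy]
      exact hx
    · rintro A ⟨a, rfl⟩ ⟨v, hva, z, hz, hzU⟩
      exact ⟨z, hπ a v hva ▸ hz, hzU⟩

end

end Continua

theorem mainTheorem5 {X : Type*} [MetricSpace X] [CompactSpace X] [ConnectedSpace X]
    (hdec : Continua.Decomposable X) (hK : Continua.KelleyProperty X)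
    (hNB : Continua.IsContinuum (Continua.NB X)) :
    (∀ x : X, IsLeast {S : Set X | ∃ A ∈ Continua.NB X, x ∈ A ∧ S = (A : Set X)}
      (Continua.minNB x)) ∧
    (∀ x : X, Minimal (fun T => T ∈ Continua.familyL X) (Continua.minNB x)) ∧
    Continua.familyL X = Continua.familyN X ∧
    Continua.IsContinuousDecomposition (Continua.familyL X) := by
  have hcov := Continua.exists_isNonblocker_mem hdec hK hNB
  have hE := Continua.minimalPoints_eq_univ hdec hK hNB.1 hcov
  have hπ : ∀ x y : X, y ∈ Continua.minNB x → Continua.minNB y = Continua.minNB x :=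
    fun x y hy => Continua.minNB_eq_of_mem_minimalPoints hcov (hE ▸ mem_univ x) hy
  have hmin : ∀ x : X, Minimal (fun T => T ∈ Continua.familyL X) (Continua.minNB x) := by
    refine fun x => ⟨⟨x, rfl⟩, ?_⟩
    rintro T ⟨y, rfl⟩ hyx
    exact (hπ x y (hyx (Continua.mem_minNB_self y))).ge
  refine ⟨fun x => ⟨?_, ?_⟩, hmin, ?_, ?_⟩
  · obtain ⟨A, hA, hAx⟩ := (Continua.isNonblocker_minNB (hcov x)).exists_mem_NB
    have hx := Continua.mem_minNB_self x
    rw [← hAx] at hx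
    exact ⟨A, hA, hx, hAx.symm⟩
  · rintro S ⟨A, hA, hx, rfl⟩
    exact Continua.minNB_subset ((Continua.mem_NB_iff A).1 hA) hx
  · ext S
    constructor
    · rintro ⟨x, rfl⟩
      exact hmin x
    · exact fun hS => hS.prop
  · exact Continua.isContinuousDecomposition_familyL hNB.1 hcov
      (Continua.isClosed_setOf_mem_minNB hdec hK hNB.1 hcov) hπ
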